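/- Let $D,K$ be integers with $2\le K\le D$, and for nonzero $v\in\{0,1\}^D$ and a permutation $\rho$ of $[D]=\{1,\dots,D\}$ put $h(\rho,v)=\min_{i:\,v_i\ne 0}\rho(i)$. Let $v,w\in\{0,1\}^D$, not both zero, have Jaccard similarity $$J=\frac{\#\{i: v_i=w_i=1\}}{\#\{i: v_i=1\text{ or }w_i=1\}}\notin\{0,1\}.$$ Let $\sigma,\pi$ be two independent uniformly random permutations of $[D]$; let $\sigma(v)$ be the vector with $\sigma(v)_{\sigma(i)}=v_i$, and for $1\le k\le K$ let $\pi_{\to k}$ be $\pi$ shifted circulantly rightwards by $k$ units, i.e. $\pi_{\to k}(i)=\pi(i-k)$ with indices taken modulo $D$. Define the C-MinHash-$(\sigma,\pi)$ estimator $$\hat J_{\sigma,\pi}=\frac1K\sum_{k=1}^K \mathbf 1\{h(\pi_{\to k},\sigma(v))=h(\pi_{\to k},\sigma(w))\}.$$ Let $\tau_1,\dots,\tau_K$ be independent uniformly random permutations of $[D]$, and define the classical MinHash estimator $$\hat J_{MH}=\frac1K\sum_{k=1}^K \mathbf 1\{h(\tau_k,v)=h(\tau_k,w)\}.$$ Then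 $$\operatorname{Var}[\hat J_{\sigma,\pi}]<\operatorname{Var}[\hat J_{MH}]=\frac{J(1-J)}{K}.$$ -/

import Mathlib

open MeasureTheory ProbabilityTheory

namespace CMinHash

/-- The finite set of permutations of `[D]` carries the discrete σ-algebra. -/
instance permMeasurableSpace (D : ℕ) : MeasurableSpace (Equiv.Perm (Fin D)) := ⊤

instance permDiscreteMeasurableSpace (D : ℕ) :
    DiscreteMeasurableSpace (Equiv.Perm (Fin D)) := ⟨fun _ => trivial⟩

/-- The Jaccard similarity of two binary vectors. (It is `0 / 0 = 0` if both vectors vanish.) -/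
noncomputable def jaccard {D : ℕ} (v w : Fin D → Fin 2) : ℝ :=
  ((Finset.univ.filter fun i => v i = 1 ∧ w i = 1).card : ℝ) /
    ((Finset.univ.filter fun i => v i = 1 ∨ w i = 1).card : ℝ)

/-- The hash value `min_{i : v_i ≠ 0} π(i)`; it is `⊤` exactly for the zero vector. -/
def hash {D : ℕ} (π : Equiv.Perm (Fin D)) (v : Fin D → Fin 2) : WithTop (Fin D) :=
  ((Finset.univ.filter fun i => v i ≠ 0).image π).min

/-- The permuted vector `σ(v)`: the entry at position `i` is moved to position `σ(i)`. -/
def permute {D : ℕ} (σ : Equiv.Perm (Fin D)) (v : Fin D → Fin 2) : Fin D → Fin 2 :=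
  fun i => v (σ.symm i)

/-- The permutation `π` shifted circulantly rightwards by `k` units: its value at `i` is
`π (i - k)`, the index being taken modulo `D` (`finRotate D` is `i ↦ i + 1` modulo `D`). -/
def circShift {D : ℕ} (π : Equiv.Perm (Fin D)) (k : ℕ) : Equiv.Perm (Fin D) :=
  π * (finRotate D ^ k)⁻¹

/-- The fraction of the `K` permutations `τ_1, …, τ_K` under which the hash values collide. -/
noncomputable def collisionFraction {D : ℕ} (K : ℕ) (τ : Fin K → Equiv.Perm (Fin D))
    (v w : Fin D → Fin 2) : ℝ :=
  (1 / (K : ℝ)) * ∑ k : Fin K, if hash (τ k) v = hash (τ k) w then (1 : ℝ) else 0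

/-- The classical MinHash estimator, from `K` permutations. -/
noncomputable def minHashEstimator {D : ℕ} (K : ℕ) (τ : Fin K → Equiv.Perm (Fin D))
    (v w : Fin D → Fin 2) : ℝ :=
  collisionFraction K τ v w

/-- The C-MinHash-(σ,π) estimator: both vectors are first permuted by `σ`, and then hashed with
the `K` circulant shifts of `π` by `1, …, K` units (`k : Fin K` stands for the shift `k + 1`). -/
noncomputable def cMinHashEstimator {D : ℕ} (K : ℕ) (σ π : Equiv.Perm (Fin D))
    (v w : Fin D → Fin 2) : ℝ :=
  collisionFraction K (fun k => circShift π ((k : ℕ) + 1)) (permute σ v) (permute σ w)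

end CMinHash

/-!
Write `S` for the union and `A` for the intersection of the supports of `v` and `w`, and put
`f = #S`, `a = #A`, so that `J = a / f`. Two hash values under a permutation `g` collide exactly when
the point of `S` at which `g` is smallest, `argmin g S`, lies in `A` (`hash_eq_hash_iff`). This
has probability `J` for uniform `g`, whence the variance `J (1 - J) / K` for independent
permutations. The strict inequality follows once every pair of distinct collision indicators of
the C-MinHash estimator is negatively correlated.

For two shifts `k ≠ l`, the substitution `g = π r σ`, with `r` the inverse of the `k`-th power of
the rotation, turns the pair of permutations into `(g, g (σ⁻¹ c σ))`, where `g` and `σ` are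
independent and uniform and `c`, a nontrivial power of the rotation, has no fixed point. Let
`N x y` count the pairs `(g, σ)` with `argmin g S = x` and `argmin (g (σ⁻¹ c σ)) S = y`. Multiplying
`g` and `σ` on the right by a transposition of two points of `S` shows that `N` takes one value on
the diagonal of `S × S` and another one off it. Elementary algebra
(`sum_sum_lt_of_swap_invariant`) then reduces the claim that both argmins lie in `A` with
probability less than `J²` to the claim that they coincide with probability less than `1 / f`.

The latter is `card_mul_card_coincide_le`. Fix a permutation `c` without fixed points and
condition on the point `t` of `S ∪ c S` at which `g` is smallest. The two argmins coincide when
the argmin over `c S` is the image under `c` of that over `S`. If `t` lies in just one of `S` and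
`c S`, it is the argmin over that set, and the argmin over the other set is still uniform on `f`
points, so the conditional probability is `1 / f`. If `t` lies in both, it is the argmin over
both, which is impossible as `c t ≠ t`. The inequality is strict if `S` meets `c S`, and since `S`
has two points, some conjugate of `c` maps one of them to the other.
-/

namespace CMinHash

open Finset Equiv

/-! ### The argmin of a permutation over a finite set -/

section Argmin

variable {α : Type*} [LinearOrder α]

/-- The point of the nonempty set `S` at which the permutation `g` takes its smallest value. -/
noncomputable def argmin (g : Perm α) (S : Finset α) (hS : S.Nonempty) : α :=
  (S.exists_min_image g hS).choose

lemma argmin_mem (g : Perm α) (S : Finset α) (hS : S.Nonempty) : argmin g S hS ∈ S :=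
  (S.exists_min_image g hS).choose_spec.1

lemma apply_argmin_le (g : Perm α) {S : Finset α} (hS : S.Nonempty) {y : α} (hy : y ∈ S) :
    g (argmin g S hS) ≤ g y :=
  (S.exists_min_image g hS).choose_spec.2 y hy

lemma argmin_eq_iff (g : Perm α) {S : Finset α} (hS : S.Nonempty) (x : α) :
    argmin g S hS = x ↔ x ∈ S ∧ ∀ y ∈ S, g x ≤ g y := by
  constructor
  · rintro rfl
    exact ⟨argmin_mem g S hS, fun y hy => apply_argmin_le g hS hy⟩
  · rintro ⟨hx, h⟩
    exact g.injective (le_antisymm (apply_argmin_le g hS hx) (h _ (argmin_mem g S hS)))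

lemma argmin_eq_of_subset (g : Perm α) {S T : Finset α} (hS : S.Nonempty) (hT : T.Nonempty)
    (hST : S ⊆ T) (h : argmin g T hT ∈ S) : argmin g S hS = argmin g T hT :=
  (argmin_eq_iff g hS _).2 ⟨h, fun _ hy => apply_argmin_le g hT (hST hy)⟩

lemma apply_argmin_mul (g ρ : Perm α) {S : Finset α} (hS : S.Nonempty) :
    ρ (argmin (g * ρ) S hS) = argmin g (S.map ρ.toEmbedding) hS.map := by
  symm
  rw [argmin_eq_iff]
  refine ⟨mem_map_of_mem _ (argmin_mem _ _ _), fun y hy => ?_⟩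
  obtain ⟨z, hz, rfl⟩ := mem_map.1 hy
  exact apply_argmin_le (g * ρ) hS hz

lemma argmin_mul_of_map_eq (g ρ : Perm α) {S : Finset α} (hS : S.Nonempty)
    (hρ : S.map ρ.toEmbedding = S) : ρ (argmin (g * ρ) S hS) = argmin g S hS := by
  rw [apply_argmin_mul]
  congr 1

lemma map_swap_eq {S : Finset α} {x y : α} (hx : x ∈ S) (hy : y ∈ S) :
    S.map (swap x y).toEmbedding = S := by
  apply eq_of_subset_of_card_le _ (by simp)
  intro z hz
  obtain ⟨u, hu, rfl⟩ := mem_map.1 hz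
  simp only [coe_toEmbedding, swap_apply_def]
  split_ifs <;> assumption

lemma argmin_eq_argmin_mul_iff (g c : Perm α) {S : Finset α} (hS : S.Nonempty) :
    argmin g S hS = argmin (g * c) S hS ↔
      argmin g (S.map c.toEmbedding) hS.map = c (argmin g S hS) := by
  rw [← apply_argmin_mul, c.injective.eq_iff, eq_comm]

/-! ### Kernels invariant under transpositions -/

/-- A kernel on `S` that is invariant under transpositions has one value on the diagonal and one
off it. If its diagonal carries less than the share `1 / #S` of its mass, then a proper nonempty
square `A × A` carries less than the share `(#A / #S) ^ 2`. -/
lemma sum_sum_lt_of_swap_invariant {S A : Finset α} (hAS : A ⊂ S) (hA : A.Nonempty)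
    (N : α → α → ℝ) (hN : ∀ u ∈ S, ∀ v ∈ S, ∀ x y, N (swap u v x) (swap u v y) = N x y)
    (hd : (#S : ℝ) * ∑ x ∈ S, N x x < ∑ x ∈ S, ∑ y ∈ S, N x y) :
    (#S : ℝ) ^ 2 * ∑ x ∈ A, ∑ y ∈ A, N x y < (#A : ℝ) ^ 2 * ∑ x ∈ S, ∑ y ∈ S, N x y := by
  obtain ⟨p, hpA⟩ := hA
  obtain ⟨q, hqS, hqA⟩ := exists_of_ssubset hAS
  have hpS := hAS.1 hpA
  have hpq : p ≠ q := by rintro rfl; exact hqA hpA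
  have diag : ∀ x ∈ S, N x x = N p p := by
    intro x hx
    rw [← hN x hx p hpS x x, swap_apply_left]
  -- Off the diagonal, a transposition can move one coordinate while it fixes the other.
  have left : ∀ x ∈ S, ∀ x' ∈ S, ∀ y, x ≠ y → x' ≠ y → N x y = N x' y := by
    intro x hx x' hx' y h h'
    rw [← hN x hx x' hx' x y, swap_apply_left, swap_apply_of_ne_of_ne h.symm h'.symm]
  have right : ∀ x, ∀ y ∈ S, ∀ y' ∈ S, x ≠ y → x ≠ y' → N x y = N x y' := by
    intro x y hy y' hy' h h'
    rw [← hN y hy y' hy' x y, swap_apply_left, swap_apply_of_ne_of_ne h h']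
  have off : ∀ x ∈ S, ∀ y ∈ S, x ≠ y → N x y = N p q := by
    intro x hx y hy h
    by_cases hpy : p = y
    · subst hpy
      rw [← hN x hx p hy x p, swap_apply_left, swap_apply_right]
      exact right p x hx q hqS h.symm hpq
    · rw [left x hx p hpS y h hpy]
      exact right p y hy q hqS hpy hpq
  have tot : ∀ B ⊆ S, ∑ x ∈ B, ∑ y ∈ B, N x y
      = #B * N p p + #B * (#B - 1) * N p q := by
    intro B hB
    have : ∀ x ∈ B, ∑ y ∈ B, N x y = N p p + (#B - 1) * N p q := by
      intro x hx
      rw [← add_sum_erase B _ hx, diag x (hB hx), sum_congr rfl (g := fun _ => N p q), sum_const,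
        card_erase_of_mem hx, nsmul_eq_mul, Nat.cast_pred (card_pos.2 ⟨x, hx⟩)]
      intro y hy
      exact off x (hB hx) y (hB (mem_of_mem_erase hy)) (ne_of_mem_erase hy).symm
    rw [sum_congr rfl this, sum_const, nsmul_eq_mul]
    ring
  rw [tot S subset_rfl, sum_congr rfl diag, sum_const, nsmul_eq_mul] at hd
  rw [tot S subset_rfl, tot A hAS.1]
  have ha : (0 : ℝ) < #A := by exact_mod_cast card_pos.2 ⟨p, hpA⟩
  have haf : (#A : ℝ) < #S := by exact_mod_cast card_lt_card hAS
  have h1 : (1 : ℝ) ≤ #A := by exact_mod_cast card_pos.2 ⟨p, hpA⟩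
  set a : ℝ := ((#A : ℕ) : ℝ)
  set f : ℝ := ((#S : ℕ) : ℝ)
  -- Both `hd` and the goal are, up to positive factors, this comparison of the two values of `N`.
  have hlt : N p p < N p q := by
    by_contra! h
    have : 0 ≤ f * (f - 1) * (N p p - N p q) :=
      mul_nonneg (mul_nonneg (by linarith) (by linarith)) (by linarith)
    nlinarith
  have : 0 < a * f * ((f - a) * (N p q - N p p)) :=
    mul_pos (mul_pos ha (by linarith)) (mul_pos (by linarith) (by linarith))
  nlinarith

/-! ### The argmin of a uniform permutation -/

variable [Fintype α]

/-- Conditionally on an event invariant under the transpositions of points of `S`, the argmin of a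
uniform permutation over `S` is uniform on `S`. -/
lemma card_mul_card_filter_argmin_eq {S : Finset α} (hS : S.Nonempty) (P : Perm α → Prop)
    [DecidablePred P] (hP : ∀ x ∈ S, ∀ y ∈ S, ∀ g, P (g * swap x y) ↔ P g) {x : α} (hx : x ∈ S) :
    #S * #{g : Perm α | P g ∧ argmin g S hS = x} = #{g : Perm α | P g} := by
  have h : ∀ y ∈ S, #{g : Perm α | P g ∧ argmin g S hS = y}
      = #{g : Perm α | P g ∧ argmin g S hS = x} := by
    intro y hy
    refine card_equiv (Equiv.mulRight (swap x y)) fun g => ?_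
    have := argmin_mul_of_map_eq g (swap x y) hS (map_swap_eq hx hy)
    simp only [mem_filter_univ, coe_mulRight, hP x hx y hy]
    rw [← this]
    refine and_congr_right fun _ => ?_
    rw [Equiv.swap_apply_eq_iff, swap_apply_right]
  rw [card_eq_sum_card_fiberwise (s := univ.filter P) (f := fun g => argmin g S hS) (t := S)
    (fun g _ => argmin_mem g S hS)]
  simp only [filter_filter]
  rw [sum_congr rfl h, sum_const, smul_eq_mul]

lemma card_mul_card_argmin_mem {S A : Finset α} (hS : S.Nonempty) (hA : A ⊆ S) :
    #S * #{g : Perm α | argmin g S hS ∈ A} = #A * Fintype.card (Perm α) := by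
  rw [card_eq_sum_card_fiberwise (f := fun g => argmin g S hS) (t := A)
    (s := univ.filter fun g : Perm α => argmin g S hS ∈ A) (fun g hg => by simpa using hg), mul_sum]
  rw [sum_congr rfl (g := fun _ => Fintype.card (Perm α)), sum_const, smul_eq_mul]
  intro x hx
  have := card_mul_card_filter_argmin_eq hS (fun _ => True) (by simp) (hA hx)
  simp only [true_and, filter_true, card_univ] at this
  rw [filter_filter, ← this]
  congr 2
  ext g
  simp only [mem_filter_univ]
  exact ⟨fun h => h.2, fun h => ⟨h ▸ hx, h⟩⟩

/-! ### Coincidence of the argmins of `g` and `g * c` -/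

/-- If the argmin `t` over `S ∪ c S` lies in only one of `S` and `c S`, then the argmins over `S`
of `g` and `g * c` coincide when the argmin over the other one of these sets is a prescribed
point. Transpositions of that set fix `t`, so this has conditional probability `1 / #S`. -/
lemma card_mul_card_argmin_union_eq (c : Perm α) {S : Finset α} (hS : S.Nonempty)
    (hT : (S ∪ S.map c.toEmbedding).Nonempty) {t : α} (ht : t ∈ S ↔ t ∉ S.map c.toEmbedding) :
    #S * #{g : Perm α | argmin g (S ∪ S.map c.toEmbedding) hT = t ∧
      argmin g S hS = argmin (g * c) S hS} =
    #{g : Perm α | argmin g (S ∪ S.map c.toEmbedding) hT = t} := by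
  have inv : ∀ U ⊆ S ∪ S.map c.toEmbedding, t ∉ U → ∀ x ∈ U, ∀ y ∈ U, ∀ g : Perm α,
      argmin (g * swap x y) _ hT = t ↔ argmin g _ hT = t := by
    intro U hU htU x hx y hy g
    rw [← argmin_mul_of_map_eq g (swap x y) hT (map_swap_eq (hU hx) (hU hy)),
      Equiv.swap_apply_eq_iff, swap_apply_of_ne_of_ne]
    · rintro rfl; exact htU hx
    · rintro rfl; exact htU hy
  simp only [argmin_eq_argmin_mul_iff]
  by_cases hs : t ∈ S
  -- Here `c t` is the prescribed argmin over `c S`; in the other case it is `c⁻¹ t`, over `S`.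
  · rw [← card_mul_card_filter_argmin_eq (S := S.map c.toEmbedding) hS.map
      (fun g => argmin g _ hT = t) (inv _ subset_union_right (ht.1 hs)) (x := c t)
      (mem_map_of_mem _ hs), card_map]
    congr 2
    ext g
    simp only [mem_filter_univ]
    refine and_congr_right fun h => ?_
    rw [argmin_eq_of_subset g hS hT subset_union_left (h ▸ hs), h]
  · have hcs : t ∈ S.map c.toEmbedding := by tauto
    obtain ⟨s, hsS, hst⟩ := mem_map.1 hcs
    rw [← card_mul_card_filter_argmin_eq hS
      (fun g => argmin g _ hT = t) (inv _ subset_union_left hs) (x := s) hsS]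
    congr 2
    ext g
    simp only [mem_filter_univ]
    refine and_congr_right fun h => ?_
    rw [argmin_eq_of_subset g hS.map hT subset_union_right (h ▸ hcs), h, ← hst, coe_toEmbedding,
      c.injective.eq_iff, eq_comm]

/-- A common point `t` of `S` and `c S` that is the argmin over `S ∪ c S` is the argmin over both
sets; coincidence would give `c t = t`. -/
lemma card_argmin_union_eq_zero (c : Perm α) (hc : ∀ x, c x ≠ x) {S : Finset α}
    (hS : S.Nonempty) (hT : (S ∪ S.map c.toEmbedding).Nonempty) {t : α} (ht : t ∈ S)
    (hct : t ∈ S.map c.toEmbedding) :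
    #{g : Perm α | argmin g (S ∪ S.map c.toEmbedding) hT = t ∧
      argmin g S hS = argmin (g * c) S hS} = 0 := by
  rw [card_eq_zero, filter_eq_empty_iff]
  rintro g - ⟨h, h'⟩
  rw [argmin_eq_argmin_mul_iff, argmin_eq_of_subset g hS hT subset_union_left (h ▸ ht),
    argmin_eq_of_subset g hS.map hT subset_union_right (h ▸ hct)] at h'
  exact hc _ h'.symm

/-- For `c` without fixed points, the argmins over `S` of a uniform `g` and of `g * c` coincide
with probability at most `1 / #S`, and less if `c` maps some point of `S` into `S`. -/
lemma card_mul_card_coincide_le (c : Perm α) (hc : ∀ x, c x ≠ x) {S : Finset α}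
    (hS : S.Nonempty) :
    #S * #{g : Perm α | argmin g S hS = argmin (g * c) S hS} ≤ Fintype.card (Perm α) ∧
    ((∃ x ∈ S, c x ∈ S) →
      #S * #{g : Perm α | argmin g S hS = argmin (g * c) S hS} < Fintype.card (Perm α)) := by
  have hT : (S ∪ S.map c.toEmbedding).Nonempty := hS.mono subset_union_left
  have fiber := fun s : Finset (Perm α) => card_eq_sum_card_fiberwise (s := s)
    (f := fun g => argmin g _ hT) (fun g _ => argmin_mem g _ hT)
  rw [← card_univ, fiber univ, fiber, mul_sum]
  simp only [filter_filter, and_comm (a := _ = argmin (_ * c) S hS)]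
  have le : ∀ t ∈ S ∪ S.map c.toEmbedding,
      #S * #{g : Perm α | argmin g (S ∪ S.map c.toEmbedding) hT = t ∧
        argmin g S hS = argmin (g * c) S hS} ≤
      #{g : Perm α | argmin g (S ∪ S.map c.toEmbedding) hT = t} := by
    intro t ht
    by_cases h : t ∈ S ∧ t ∈ S.map c.toEmbedding
    · rw [card_argmin_union_eq_zero c hc hS hT h.1 h.2, mul_zero]
      exact Nat.zero_le _
    · rw [mem_union] at ht
      exact (card_mul_card_argmin_union_eq c hS hT (by tauto)).le
  refine ⟨sum_le_sum le, ?_⟩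
  rintro ⟨x, hx, hcx⟩
  have hcT : c x ∈ S ∪ S.map c.toEmbedding := mem_union_left _ hcx
  refine sum_lt_sum le ⟨c x, hcT, ?_⟩
  rw [card_argmin_union_eq_zero c hc hS hT hcx (mem_map_of_mem _ hx), mul_zero]
  have := card_mul_card_filter_argmin_eq hT (fun _ => True) (by simp) hcT
  simp only [true_and, filter_true, card_univ] at this
  exact pos_of_mul_pos_right (this ▸ Fintype.card_pos) (Nat.zero_le _)

/-! ### The joint law of the argmins for a random conjugate of `c` -/

/-- For `c` without fixed points and independent uniform `g` and `s`, the argmins over `S` of `g`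
and of `g * (s⁻¹ * c * s)` both lie in the proper nonempty subset `A` with
probability less than `(#A / #S) ^ 2`. -/
lemma sq_mul_card_joint_lt (c : Perm α) (hc : ∀ x, c x ≠ x) {S A : Finset α}
    (hS : S.Nonempty) (hA : A.Nonempty) (hAS : A ⊂ S) :
    (#S : ℝ) ^ 2 * #{p : Perm α × Perm α | argmin p.1 S hS ∈ A ∧
        argmin (p.1 * (p.2⁻¹ * c * p.2)) S hS ∈ A} <
      (#A : ℝ) ^ 2 * (Fintype.card (Perm α) : ℝ) ^ 2 := by
  let N : α → α → ℕ := fun x y => #{p : Perm α × Perm α | argmin p.1 S hS = x ∧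
        argmin (p.1 * (p.2⁻¹ * c * p.2)) S hS = y}
  have hN : ∀ u ∈ S, ∀ v ∈ S, ∀ x y, N (swap u v x) (swap u v y) = N x y := by
    intro u hu v hv x y
    refine card_equiv ((Equiv.mulRight (swap u v)).prodCongr (Equiv.mulRight (swap u v)))
      fun p => ?_
    have h1 := argmin_mul_of_map_eq p.1 (swap u v) hS (map_swap_eq hu hv)
    have h2 := argmin_mul_of_map_eq (p.1 * (p.2⁻¹ * c * p.2)) (swap u v) hS (map_swap_eq hu hv)
    simp only [mem_filter_univ, prodCongr_apply, Prod.map, coe_mulRight]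
    rw [← h1, ← h2, (swap u v).injective.eq_iff, (swap u v).injective.eq_iff]
    simp only [mul_inv_rev, mul_assoc, mul_inv_cancel_left]
  have hsum : ∀ B ⊆ S, ∑ x ∈ B, ∑ y ∈ B, N x y = #{p : Perm α × Perm α | argmin p.1 S hS ∈ B ∧
        argmin (p.1 * (p.2⁻¹ * c * p.2)) S hS ∈ B} := by
    intro B hB
    rw [← sum_product' B B N, card_eq_sum_card_fiberwise (t := B ×ˢ B)
      (f := fun p : Perm α × Perm α =>
        (argmin p.1 S hS, argmin (p.1 * (p.2⁻¹ * c * p.2)) S hS))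
      (fun p hp => by simpa using hp)]
    refine sum_congr rfl fun x hx => ?_
    simp only [N, filter_filter, Prod.ext_iff]
    congr 1
    ext p
    simp only [mem_filter_univ]
    rw [mem_product] at hx
    constructor
    · rintro ⟨h1, h2⟩; exact ⟨⟨h1 ▸ hx.1, h2 ▸ hx.2⟩, h1, h2⟩
    · exact fun h => h.2
  have hall : ∑ x ∈ S, ∑ y ∈ S, N x y = Fintype.card (Perm α) ^ 2 := by
    rw [hsum S subset_rfl]
    simp [argmin_mem, sq]
  have hdiag : #S * ∑ x ∈ S, N x x < Fintype.card (Perm α) ^ 2 := by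
    have e : ∑ x ∈ S, N x x = ∑ s : Perm α,
        #{g : Perm α | argmin g S hS = argmin (g * (s⁻¹ * c * s)) S hS} := by
      have : ∑ x ∈ S, N x x = #{p : Perm α × Perm α | argmin p.1 S hS =
          argmin (p.1 * (p.2⁻¹ * c * p.2)) S hS} := by
        rw [card_eq_sum_card_fiberwise (t := S) (f := fun p : Perm α × Perm α => argmin p.1 S hS)
          (fun p _ => argmin_mem _ _ _)]
        refine sum_congr rfl fun x hx => ?_
        simp only [N, filter_filter]
        congr 1
        ext p
        simp only [mem_filter_univ]
        constructor
        · rintro ⟨h1, h2⟩; exact ⟨h1.trans h2.symm, h1⟩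
        · rintro ⟨h1, h2⟩; exact ⟨h2, h1 ▸ h2⟩
      rw [this]
      simp only [card_filter]
      rw [Fintype.sum_prod_type, sum_comm]
    have hfree : ∀ s : Perm α, ∀ x, (s⁻¹ * c * s) x ≠ x := by
      intro s x h
      apply hc (s x)
      rwa [Perm.mul_apply, Perm.mul_apply, Perm.inv_eq_iff_eq] at h
    rw [e, mul_sum, sq, ← smul_eq_mul (Fintype.card (Perm α)), ← card_univ, ← sum_const]
    refine sum_lt_sum (fun s _ => (card_mul_card_coincide_le _ (hfree s) hS).1) ?_
    -- `S` has two elements `p ≠ q`; some conjugate of `c` sends `p` to `q`.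
    obtain ⟨p, hp⟩ := hA
    obtain ⟨q, hq, hqA⟩ := exists_of_ssubset hAS
    have hpq : q ≠ p := by rintro rfl; exact hqA hp
    refine ⟨swap q (c p), mem_univ _, (card_mul_card_coincide_le _ (hfree _) hS).2
      ⟨p, hAS.1 hp, ?_⟩⟩
    simp [swap_apply_of_ne_of_ne hpq.symm (hc p).symm, hq]
  have := sum_sum_lt_of_swap_invariant hAS hA (fun x y => (N x y : ℝ))
    (fun u hu v hv x y => by simp only [hN u hu v hv x y])
    (by exact_mod_cast hall ▸ hdiag)
  rw [← hsum A hAS.1]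
  have h := congrArg (fun n : ℕ => (n : ℝ)) hall
  push_cast at this h ⊢
  rwa [h] at this

end Argmin

/-! ### Hash collisions and circulant shifts -/

section Hash

variable {D : ℕ}

/-- The set of positions at which at least one of two binary vectors is `1`. -/
def unionSupport (v w : Fin D → Fin 2) : Finset (Fin D) := {i | v i = 1 ∨ w i = 1}

/-- The set of positions at which both of two binary vectors are `1`. -/
def interSupport (v w : Fin D → Fin 2) : Finset (Fin D) := {i | v i = 1 ∧ w i = 1}

lemma jaccard_eq (v w : Fin D → Fin 2) :
    jaccard v w = (#(interSupport v w) : ℝ) / #(unionSupport v w) := rfl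

lemma interSupport_subset (v w : Fin D → Fin 2) : interSupport v w ⊆ unionSupport v w :=
  monotone_filter_right _ fun _ _ h => Or.inl h.1

lemma hash_eq_coe (g : Perm (Fin D)) (v : Fin D → Fin 2) {i : Fin D} (hi : v i = 1)
    (h : ∀ j, v j = 1 → g i ≤ g j) : hash g v = (g i : WithTop (Fin D)) := by
  refine le_antisymm (Finset.min_le (mem_image_of_mem _ (by simp [hi])))
    (Finset.le_min fun y hy => ?_)
  obtain ⟨j, hj, rfl⟩ := mem_image.1 hy
  exact WithTop.coe_le_coe.2 (h j (Fin.eq_one_of_ne_zero _ (mem_filter.1 hj).2))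

lemma eq_one_of_hash_eq_coe {g : Perm (Fin D)} {v : Fin D → Fin 2} {i : Fin D}
    (h : hash g v = (g i : WithTop (Fin D))) : v i = 1 := by
  obtain ⟨j, hj, hji⟩ := mem_image.1 (mem_of_min h)
  exact g.injective hji ▸ Fin.eq_one_of_ne_zero _ (mem_filter.1 hj).2

lemma hash_eq_hash_iff (g : Perm (Fin D)) (v w : Fin D → Fin 2)
    (hS : (unionSupport v w).Nonempty) :
    hash g v = hash g w ↔ argmin g (unionSupport v w) hS ∈ interSupport v w := by
  have hle : ∀ j, v j = 1 ∨ w j = 1 → g (argmin g _ hS) ≤ g j := fun j hj =>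
    apply_argmin_le g hS ((mem_filter_univ j).2 hj)
  have hmem := (mem_filter_univ _).1 (argmin_mem g _ hS)
  have hv := hash_eq_coe g v (i := argmin g _ hS) (h := fun j hj => hle j (Or.inl hj))
  have hw := hash_eq_coe g w (i := argmin g _ hS) (h := fun j hj => hle j (Or.inr hj))
  rw [interSupport, mem_filter_univ]
  constructor
  · intro h
    rcases hmem with h1 | h1
    · exact ⟨h1, eq_one_of_hash_eq_coe (h ▸ hv h1)⟩
    · exact ⟨eq_one_of_hash_eq_coe (h ▸ hw h1), h1⟩
  · rintro ⟨h1, h2⟩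
    rw [hv h1, hw h2]

lemma hash_permute (g s : Perm (Fin D)) (v : Fin D → Fin 2) :
    hash g (permute s v) = hash (g * s) v := by
  rw [hash, hash]
  congr 1
  ext y
  rw [mem_image, mem_image]
  constructor
  · rintro ⟨i, hi, rfl⟩
    exact ⟨s.symm i, mem_filter.2 ⟨mem_univ _, (mem_filter.1 hi).2⟩, by simp⟩
  · rintro ⟨i, hi, rfl⟩
    exact ⟨s i, (mem_filter_univ _).2 (by simpa [permute] using hi), rfl⟩

/-- The indicator of the event that `v` and `w` have the same hash value under `g`. -/
noncomputable def collision (v w : Fin D → Fin 2) (g : Perm (Fin D)) : ℝ :=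
  if hash g v = hash g w then 1 else 0

lemma cMinHashEstimator_eq (K : ℕ) (s p : Perm (Fin D)) (v w : Fin D → Fin 2) :
    cMinHashEstimator K s p v w = (1 / (K : ℝ)) *
      ∑ k : Fin K, collision v w (p * (finRotate D ^ ((k : ℕ) + 1))⁻¹ * s) := by
  simp only [cMinHashEstimator, collisionFraction, hash_permute, circShift, collision]

lemma collision_mul_self (v w : Fin D → Fin 2) (g : Perm (Fin D)) :
    collision v w g * collision v w g = collision v w g := by
  simp [collision]

/-- Powers of the rotation whose distinct exponents differ by less than `D` agree at no point. -/
lemma finRotate_pow_apply_ne {D m n : ℕ} (hD : 2 ≤ D) (hmn : m < n) (hnm : n < m + D)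
    (x : Fin D) : (finRotate D ^ n) x ≠ (finRotate D ^ m) x := by
  intro h
  obtain ⟨d, rfl⟩ := Nat.exists_eq_add_of_lt hmn
  rw [add_assoc, pow_add, Perm.mul_apply, (finRotate D ^ m).injective.eq_iff] at h
  have hc := isCycle_finRotate_of_le hD
  have hx : finRotate D x ≠ x := by
    rw [← Perm.mem_support, support_finRotate_of_le hD]; exact mem_univ x
  have h1 := orderOf_dvd_of_pow_eq_one ((hc.pow_eq_one_iff' hx).2 h)
  rw [hc.orderOf, support_finRotate_of_le hD, card_univ, Fintype.card_fin] at h1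
  have := Nat.le_of_dvd (by lia) h1
  lia

lemma finRotate_pow_mul_inv_apply_ne {K : ℕ} (hK : 2 ≤ K) (hKD : K ≤ D) {k l : Fin K}
    (hkl : k ≠ l) (x : Fin D) :
    ((finRotate D ^ ((k : ℕ) + 1)) * (finRotate D ^ ((l : ℕ) + 1))⁻¹) x ≠ x := by
  obtain ⟨y, rfl⟩ := (finRotate D ^ ((l : ℕ) + 1)).surjective x
  rw [← Perm.mul_apply, inv_mul_cancel_right]
  rcases lt_or_gt_of_ne hkl with h | h
  · exact (finRotate_pow_apply_ne (by lia) (by simpa using h) (by lia) y).symm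
  · exact finRotate_pow_apply_ne (by lia) (by simpa using h) (by lia) y

end Hash

/-! ### A change of variables in a finite group -/

section Group

variable {G : Type*} [Group G]

/-- The change of variables `(s, p) ↦ (p * r * s, s)` on pairs of group elements. -/
def mulMulEquiv (r : G) : G × G ≃ G × G where
  toFun q := (q.2 * r * q.1, q.1)
  invFun p := (p.2, p.1 * p.2⁻¹ * r⁻¹)
  left_inv q := by simp
  right_inv p := by simp

/-- If `s` and `p` are independent and uniform, then `p * r * s` is uniform. -/
lemma sum_mul_mul [Fintype G] (r : G) (F : G → ℝ) :
    ∑ q : G × G, F (q.2 * r * q.1) = Fintype.card G * ∑ g, F g := by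
  rw [show ∑ q : G × G, F (q.2 * r * q.1) = _ from
    (mulMulEquiv r).sum_comp fun p : G × G => F p.1, Fintype.sum_prod_type]
  simp [mul_sum]

end Group

/-! ### Uniform random variables on a finite type -/

section Law

variable {Ω : Type*} [MeasurableSpace Ω] {μ : Measure Ω} {β : Type*} [MeasurableSpace β]
  [Fintype β] [DiscreteMeasurableSpace β] {X : Ω → β}

lemma integral_of_hasLaw_uniformOn [Nonempty β] (hX : HasLaw X (uniformOn Set.univ) μ)
    (F : β → ℝ) : ∫ ω, F (X ω) ∂μ = (∑ b, F b) / Fintype.card β := by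
  rw [show ∫ ω, F (X ω) ∂μ = _ from
      hX.integral_comp (f := F) (measurable_of_finite F).aestronglyMeasurable,
    integral_fintype Integrable.of_finite, sum_div]
  refine sum_congr rfl fun b _ => ?_
  rw [measureReal_def, uniformOn_univ, Measure.count_singleton]
  simp [div_eq_inv_mul]

lemma memLp_of_hasLaw_uniformOn [Nonempty β] (hX : HasLaw X (uniformOn Set.univ) μ)
    (F : β → ℝ) : MemLp (fun ω => F (X ω)) 2 μ := by
  refine MemLp.comp_of_map (g := F) ?_ hX.aemeasurable
  rw [hX.map_eq]
  exact MemLp.of_discrete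

lemma hasLaw_prodMk_uniformOn [Nonempty β] [IsProbabilityMeasure μ] {Y : Ω → β}
    (hX : HasLaw X (uniformOn Set.univ) μ) (hY : HasLaw Y (uniformOn Set.univ) μ)
    (hXY : IndepFun X Y μ) : HasLaw (fun ω => (X ω, Y ω)) (uniformOn Set.univ) μ := by
  have h := (indepFun_iff_hasLaw_prodMk_prod hX hY).1 hXY
  convert h
  refine (Measure.ext_of_singleton fun ⟨a, b⟩ => ?_)
  rw [← Set.singleton_prod_singleton, Measure.prod_prod, Set.singleton_prod_singleton]
  simp only [uniformOn_univ, Measure.count_singleton, Fintype.card_prod, Nat.cast_mul, one_div]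
  rw [ENNReal.mul_inv] <;> simp

end Law

/-! ### Variance of an average -/

section Var

variable {Ω : Type*} [MeasurableSpace Ω] {μ : Measure Ω} [IsProbabilityMeasure μ] {K : ℕ}
  {X : Fin K → Ω → ℝ} {V : ℝ}

lemma variance_average_eq (hK : K ≠ 0) (hX : ∀ k, MemLp (X k) 2 μ)
    (hV : ∀ k, cov[X k, X k; μ] = V) (hc : ∀ k l, k ≠ l → cov[X k, X l; μ] = 0) :
    Var[fun ω => (1 / (K : ℝ)) * ∑ k, X k ω; μ] = V / K := by
  have h : ∀ k, ∑ l, cov[X k, X l; μ] = V := fun k => by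
    rw [Fintype.sum_eq_single k fun l hl => hc k l hl.symm, hV]
  rw [variance_const_mul, variance_fun_sum hX, sum_congr rfl fun k _ => h k]
  simp only [sum_const, card_univ, Fintype.card_fin, nsmul_eq_mul]
  field_simp

lemma variance_average_lt (hK : 2 ≤ K) (hX : ∀ k, MemLp (X k) 2 μ)
    (hV : ∀ k, cov[X k, X k; μ] = V) (hc : ∀ k l, k ≠ l → cov[X k, X l; μ] < 0) :
    Var[fun ω => (1 / (K : ℝ)) * ∑ k, X k ω; μ] < V / K := by
  have : Nontrivial (Fin K) := Fin.nontrivial_iff_two_le.2 hK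
  have h : ∀ k, ∑ l, cov[X k, X l; μ] < V := fun k => by
    obtain ⟨l, hl⟩ := exists_ne k
    rw [← add_sum_erase _ _ (mem_univ k), hV]
    have : ∑ l ∈ univ.erase k, cov[X k, X l; μ] < 0 :=
      sum_neg (fun l hl => hc k l (ne_of_mem_erase hl).symm) ⟨l, mem_erase.2 ⟨hl, mem_univ l⟩⟩
    linarith
  have hK0 : (0 : ℝ) < K := by exact_mod_cast (by lia : 0 < K)
  have : ∑ k, ∑ l, cov[X k, X l; μ] < ∑ _k : Fin K, V :=
    sum_lt_sum_of_nonempty ⟨⟨0, by lia⟩, mem_univ _⟩ fun k _ => h k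
  rw [variance_const_mul, variance_fun_sum hX]
  calc (1 / (K : ℝ)) ^ 2 * ∑ k, ∑ l, cov[X k, X l; μ] < (1 / (K : ℝ)) ^ 2 * ∑ _k : Fin K, V := by
        gcongr
    _ = V / K := by
        simp only [sum_const, card_univ, Fintype.card_fin, nsmul_eq_mul]
        field_simp

end Var

/-! ### Moments of the collision indicators and the two variances -/

section Moments
variable {D : ℕ} {v w : Fin D → Fin 2}

lemma interSupport_nonempty (hJ0 : jaccard v w ≠ 0) : (interSupport v w).Nonempty := by
  rw [nonempty_iff_ne_empty]
  intro h
  exact hJ0 (by simp [jaccard_eq, h])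

lemma unionSupport_nonempty (hJ0 : jaccard v w ≠ 0) : (unionSupport v w).Nonempty :=
  (interSupport_nonempty hJ0).mono (interSupport_subset v w)

lemma interSupport_ssubset (hJ0 : jaccard v w ≠ 0) (hJ1 : jaccard v w ≠ 1) :
    interSupport v w ⊂ unionSupport v w := by
  refine (interSupport_subset v w).ssubset_of_ne fun h => hJ1 ?_
  rw [jaccard_eq, h, div_self]
  exact_mod_cast (card_pos.2 (unionSupport_nonempty hJ0)).ne'

/-- The collision probability of a uniform permutation is the Jaccard similarity. -/
lemma sum_collision (hJ0 : jaccard v w ≠ 0) :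
    ∑ g, collision v w g = jaccard v w * Fintype.card (Perm (Fin D)) := by
  have hS := unionSupport_nonempty hJ0
  have h := card_mul_card_argmin_mem hS (interSupport_subset v w)
  have hf : (#(unionSupport v w) : ℝ) ≠ 0 := by exact_mod_cast (card_pos.2 hS).ne'
  simp only [collision, hash_eq_hash_iff _ v w hS, sum_boole]
  rw [jaccard_eq, div_mul_eq_mul_div, eq_div_iff hf, mul_comm]
  exact_mod_cast h

/-- For independent uniform `s` and `p`, the permutations `p * r * s` and `p * r' * s`, where `r` and
`r'` agree at no point, both produce a collision with probability less than the square of the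
Jaccard similarity. -/
lemma sum_collision_mul_collision_lt (hJ0 : jaccard v w ≠ 0) (hJ1 : jaccard v w ≠ 1)
    (r r' : Perm (Fin D)) (hr : ∀ x, (r⁻¹ * r') x ≠ x) :
    ∑ q : Perm (Fin D) × Perm (Fin D),
        collision v w (q.2 * r * q.1) * collision v w (q.2 * r' * q.1) <
      (jaccard v w) ^ 2 * (Fintype.card (Perm (Fin D)) : ℝ) ^ 2 := by
  have hS := unionSupport_nonempty hJ0
  have hf : (0 : ℝ) < #(unionSupport v w) := by exact_mod_cast card_pos.2 hS
  have h := sq_mul_card_joint_lt (r⁻¹ * r') hr hS (interSupport_nonempty hJ0)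
    (interSupport_ssubset hJ0 hJ1)
  have e : ∀ q : Perm (Fin D) × Perm (Fin D), q.2 * r' * q.1 =
      (mulMulEquiv r q).1 * ((mulMulEquiv r q).2⁻¹ * (r⁻¹ * r') * (mulMulEquiv r q).2) := by
    intro q
    simp [mulMulEquiv, mul_assoc]
  simp only [e]
  rw [show (∑ q : Perm (Fin D) × Perm (Fin D), collision v w (q.2 * r * q.1) * _) = _ from
    (mulMulEquiv r).sum_comp fun p : Perm (Fin D) × Perm (Fin D) =>
      collision v w p.1 * collision v w (p.1 * (p.2⁻¹ * (r⁻¹ * r') * p.2))]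
  simp only [collision, hash_eq_hash_iff _ v w hS, ite_zero_mul_ite_zero, mul_one, sum_boole]
  rw [jaccard_eq, div_pow, div_mul_eq_mul_div, lt_div_iff₀ (by positivity), mul_comm]
  exact h

variable {K : ℕ} {Ω : Type*} [MeasurableSpace Ω] {μ : Measure Ω} [IsProbabilityMeasure μ]

lemma covariance_self_of_indicator {X : Ω → ℝ} {J : ℝ} (hX : MemLp X 2 μ)
    (hsq : ∀ ω, X ω * X ω = X ω) (hJ : ∫ ω, X ω ∂μ = J) : cov[X, X; μ] = J * (1 - J) := by
  rw [covariance_eq_sub hX hX]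
  simp only [Pi.mul_apply, hsq, hJ]
  ring

theorem variance_minHashEstimator (hK : K ≠ 0) (hJ0 : jaccard v w ≠ 0)
    {τ : Fin K → Ω → Perm (Fin D)} (hτ : ∀ k, HasLaw (τ k) (uniformOn Set.univ) μ)
    (hτi : iIndepFun τ μ) :
    Var[fun ω => minHashEstimator K (fun k => τ k ω) v w; μ]
      = jaccard v w * (1 - jaccard v w) / K := by
  have hL : ∀ k, MemLp (fun ω => collision v w (τ k ω)) 2 μ := fun k =>
    memLp_of_hasLaw_uniformOn (hτ k) (collision v w)
  refine variance_average_eq (X := fun k ω => collision v w (τ k ω)) hK hL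
    (fun k => covariance_self_of_indicator (hL k) (fun ω => collision_mul_self v w _) ?_)
    fun k l hkl => ?_
  · rw [integral_of_hasLaw_uniformOn (hτ k), sum_collision hJ0]
    exact mul_div_cancel_right₀ _ (Nat.cast_ne_zero.2 Fintype.card_ne_zero)
  · exact ((hτi.indepFun hkl).comp (measurable_of_finite (collision v w))
      (measurable_of_finite (collision v w))).covariance_eq_zero (hL k) (hL l)

theorem variance_cMinHashEstimator_lt (hK : 2 ≤ K) (hKD : K ≤ D) (hJ0 : jaccard v w ≠ 0)
    (hJ1 : jaccard v w ≠ 1) {σ π : Ω → Perm (Fin D)} (hσ : HasLaw σ (uniformOn Set.univ) μ)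
    (hπ : HasLaw π (uniformOn Set.univ) μ) (hσπ : IndepFun σ π μ) :
    Var[fun ω => cMinHashEstimator K (σ ω) (π ω) v w; μ]
      < jaccard v w * (1 - jaccard v w) / K := by
  have hN : (0 : ℝ) < Fintype.card (Perm (Fin D)) := by exact_mod_cast Fintype.card_pos
  have hlaw := hasLaw_prodMk_uniformOn hσ hπ hσπ
  let r : Fin K → Perm (Fin D) := fun k => (finRotate D ^ ((k : ℕ) + 1))⁻¹
  have hL : ∀ k, MemLp (fun ω => collision v w (π ω * r k * σ ω)) 2 μ := fun k =>
    memLp_of_hasLaw_uniformOn hlaw fun q => collision v w (q.2 * r k * q.1)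
  have hE : ∀ k, ∫ ω, collision v w (π ω * r k * σ ω) ∂μ = jaccard v w := fun k => by
    rw [integral_of_hasLaw_uniformOn hlaw fun q => collision v w (q.2 * r k * q.1), sum_mul_mul,
      sum_collision hJ0, Fintype.card_prod, Nat.cast_mul]
    field_simp
  simp only [cMinHashEstimator_eq]
  refine variance_average_lt (X := fun k ω => collision v w (π ω * r k * σ ω)) hK hL
    (fun k => covariance_self_of_indicator (hL k) (fun ω => collision_mul_self v w _) (hE k))
    fun k l hkl => ?_
  rw [covariance_eq_sub (hL k) (hL l), hE, hE, sub_neg, ← sq]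
  simp only [Pi.mul_apply]
  rw [integral_of_hasLaw_uniformOn hlaw fun q =>
    collision v w (q.2 * r k * q.1) * collision v w (q.2 * r l * q.1),
    Fintype.card_prod, Nat.cast_mul, ← sq, div_lt_iff₀ (by positivity)]
  refine sum_collision_mul_collision_lt hJ0 hJ1 _ _ fun x => ?_
  rw [inv_inv]
  exact finRotate_pow_mul_inv_apply_ne hK hKD hkl x

end Moments

end CMinHash

theorem theorem3p4 (D K : ℕ) (hK : 2 ≤ K) (hKD : K ≤ D) (v w : Fin D → Fin 2)
    (hJ0 : CMinHash.jaccard v w ≠ 0) (hJ1 : CMinHash.jaccard v w ≠ 1)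
    {Ω : Type*} [MeasurableSpace Ω] (μ : Measure Ω) [IsProbabilityMeasure μ]
    (σ π : Ω → Equiv.Perm (Fin D))
    (hσ : HasLaw σ (uniformOn Set.univ) μ) (hπ : HasLaw π (uniformOn Set.univ) μ)
    (hσπ : IndepFun σ π μ)
    {Ω' : Type*} [MeasurableSpace Ω'] (ν : Measure Ω') [IsProbabilityMeasure ν]
    (τ : Fin K → Ω' → Equiv.Perm (Fin D))
    (hτ : ∀ k, HasLaw (τ k) (uniformOn Set.univ) ν) (hτi : iIndepFun τ ν) :
    variance (fun ω => CMinHash.cMinHashEstimator K (σ ω) (π ω) v w) μ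
        < variance (fun ω => CMinHash.minHashEstimator K (fun k => τ k ω) v w) ν ∧
      variance (fun ω => CMinHash.minHashEstimator K (fun k => τ k ω) v w) ν
        = CMinHash.jaccard v w * (1 - CMinHash.jaccard v w) / K := by
  have hMH := CMinHash.variance_minHashEstimator (by lia) hJ0 hτ hτi
  exact ⟨hMH ▸ CMinHash.variance_cMinHashEstimator_lt hK hKD hJ0 hJ1 hσ hπ hσπ, hMH⟩
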